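/- Let $H$ be a complex Hilbert space. For a bounded operator $S : H_1 \to H_2$ between complex Hilbert spaces put $m(S) = \inf\{\|Sx\| : x\in H_1,\ \|x\| = 1\}$, and call $S$ minimum attaining if $\|Sx_0\| = m(S)$ for some $x_0\in H_1$ with $\|x_0\| = 1$. A bounded operator $T$ on $H$ is absolutely minimum attaining if the restriction $T|_M : M \to H$ is minimum attaining for every nonzero closed subspace $M$ of $H$. Let $T$ be a bounded operator on $H$ that is absolutely minimum attaining, positive (self-adjoint with $\langle Tx,x\rangle\ge 0$ for all $x$) and one-to-one. Then there are an orthonormal basis $\{v_\alpha : \alpha\in\Lambda\}$ of $H$ and real numbers $\mu_\alpha\ge 0$ with $Tv_\alpha = \mu_\alpha v_\alpha$ for every $\alpha\in\Lambda$, such that $$T = \sum_{\alpha\in\Lambda}\mu_\alpha\, v_\alpha\otimes v_\alpha, \qquad\text{i.e. } Tx = \sum_{\alpha\in\Lambda}\mu_\alpha\langle x,v_\alpha\rangle v_\alpha \text{ for all } x\in H$$ (convergence in norm of the net of finite partial sums), and: 1. for every nonempty $\Gamma\subseteq\Lambda$, the infimum $\inf\{\mu_\alpha : \alpha\in\Gamma\}$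 is attained, i.e. is a minimum; 2. the spectrum is $\sigma(T) = \overline{\{\mu_\alpha : \alpha\in\Lambda\}}$ and has at most one limit point. If there is a limit point $\ell$, it is real, it is the limit of a strictly increasing sequence in $\sigma(T)$, and it can be approached only from below: every sequence in $\sigma(T)\setminus\{\ell\}$ converging to $\ell$ eventually consists of numbers less than $\ell$; 3. the set of eigenvalues of $T$ is $\{\mu_\alpha : \alpha\in\Lambda\}$; it is countable, and at most one eigenvalue has infinite multiplicity (infinite-dimensional eigenspace); 4. if $\sigma(T)$ has a limit point and $T$ has an eigenvalue of infinite multiplicity, then the two are equal. -/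

import Mathlib

open Filter Topology

/-- The minimum modulus `m(T) = inf {‖T x‖ : ‖x‖ = 1}` of a bounded operator. -/
noncomputable def minModulus {E F : Type*} [NormedAddCommGroup E] [NormedSpace ℂ E]
    [NormedAddCommGroup F] [NormedSpace ℂ F] (T : E →L[ℂ] F) : ℝ :=
  sInf {r : ℝ | ∃ x : E, ‖x‖ = 1 ∧ ‖T x‖ = r}

/-- `T` is minimum attaining: `‖T x₀‖ = m(T)` for some unit vector `x₀`. -/
def IsMinAttaining {E F : Type*} [NormedAddCommGroup E] [NormedSpace ℂ E]
    [NormedAddCommGroup F] [NormedSpace ℂ F] (T : E →L[ℂ] F) : Prop :=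
  ∃ x : E, ‖x‖ = 1 ∧ ‖T x‖ = minModulus T

/-- `T` is absolutely minimum attaining: its restriction to every nonzero closed subspace
is minimum attaining. -/
def IsAbsMinAttaining {E F : Type*} [NormedAddCommGroup E] [NormedSpace ℂ E]
    [NormedAddCommGroup F] [NormedSpace ℂ F] (T : E →L[ℂ] F) : Prop :=
  ∀ M : Submodule ℂ E, IsClosed (M : Set E) → M ≠ ⊥ → IsMinAttaining (T.comp M.subtypeL)

/-! One obstruction drives the proof: if an orthonormal sequence has pairwise orthogonal images of
strictly decreasing norms, no minimum is attained on its closed span, because every coordinate of a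
minimiser would vanish (`not_isAbsMinAttaining_of_strictAnti`).

On a closed invariant subspace a minimiser of `‖T x‖` is an eigenvector of `T ^ 2`, hence of `T` by
positivity; Zorn's lemma then yields an eigenbasis.

Applied to eigenvectors, the obstruction makes the eigenvalues well-ordered. Hence infima are
attained, there is a gap above every real number, the eigenvalues are countable, and limit points
are approached only from below. Applied to mixtures of eigenvectors from the two sides of a gap `A <
B`, it shows that one side carries only finitely many indices, counted with multiplicity
(`IsAbsMinAttaining.finite_or_finite`). Limit points of the spectrum and eigenvalues of infinite
multiplicity both have infinitely many indices in each neighbourhood, so all of them coincide. -/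

theorem minModulus_le {E F : Type*} [NormedAddCommGroup E] [NormedSpace ℂ E]
    [NormedAddCommGroup F] [NormedSpace ℂ F] (T : E →L[ℂ] F) {x : E} (hx : ‖x‖ = 1) :
    minModulus T ≤ ‖T x‖ :=
  csInf_le ⟨0, by rintro r ⟨y, -, rfl⟩; exact norm_nonneg _⟩ ⟨x, hx, rfl⟩

theorem minModulus_nonneg {E F : Type*} [NormedAddCommGroup E] [NormedSpace ℂ E]
    [NormedAddCommGroup F] [NormedSpace ℂ F] (T : E →L[ℂ] F) : 0 ≤ minModulus T :=
  Real.sInf_nonneg (by rintro r ⟨y, -, rfl⟩; exact norm_nonneg _)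

/-! ### The obstruction to attaining a minimum -/

section

variable {E F : Type*} [NormedAddCommGroup E] [InnerProductSpace ℂ E]
  [NormedAddCommGroup F] [InnerProductSpace ℂ F]

/-- Pythagoras for a finite linear combination of pairwise orthogonal vectors. -/
theorem norm_sq_sum_smul_of_pairwise_inner_eq_zero {ι : Type*} {w : ι → F}
    (hw : Pairwise fun i j => inner ℂ (w i) (w j) = 0) (c : ι → ℂ) (s : Finset ι) :
    ‖∑ i ∈ s, c i • w i‖ ^ 2 = ∑ i ∈ s, ‖c i‖ ^ 2 * ‖w i‖ ^ 2 := by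
  classical
  induction s using Finset.induction_on with
  | empty => simp
  | insert a s ha ih =>
    rw [Finset.sum_insert ha, Finset.sum_insert ha, ← ih, sq, sq,
      norm_add_sq_eq_norm_sq_add_norm_sq_of_inner_eq_zero (𝕜 := ℂ), norm_smul]
    · ring
    · rw [inner_sum]
      refine Finset.sum_eq_zero fun i hi => ?_
      rw [inner_smul_left, inner_smul_right, hw (by rintro rfl; exact ha hi)]
      simp

/-- If `T` maps an orthonormal family to pairwise orthogonal vectors of norm at least `L`, then on
the closed span of the family `‖T x‖ ^ 2 - L ^ 2 * ‖x‖ ^ 2` dominates each of its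
coordinate contributions. -/
theorem norm_sq_inner_mul_le_of_mem_closure_span {ι : Type*} (T : E →L[ℂ] F) {u : ι → E}
    (hu : Orthonormal ℂ u) (hTu : Pairwise fun i j => inner ℂ (T (u i)) (T (u j)) = 0)
    {L : ℝ} (hL : 0 ≤ L) (hLu : ∀ i, L ≤ ‖T (u i)‖) (k : ι) {x : E}
    (hx : x ∈ (Submodule.span ℂ (Set.range u)).topologicalClosure) :
    ‖inner ℂ (u k) x‖ ^ 2 * (‖T (u k)‖ ^ 2 - L ^ 2) ≤ ‖T x‖ ^ 2 - L ^ 2 * ‖x‖ ^ 2 := by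
  classical
  have hclosed : IsClosed {x : E | ‖inner ℂ (u k) x‖ ^ 2 * (‖T (u k)‖ ^ 2 - L ^ 2) ≤
      ‖T x‖ ^ 2 - L ^ 2 * ‖x‖ ^ 2} :=
    isClosed_le (by fun_prop) (by fun_prop)
  refine closure_minimal (s := (Submodule.span ℂ (Set.range u) : Set E)) ?_ hclosed hx
  intro x hx
  obtain ⟨c, rfl⟩ := Finsupp.mem_span_range_iff_exists_finsupp.1 hx
  have hsq (i : ι) : 0 ≤ ‖T (u i)‖ ^ 2 - L ^ 2 :=
    sub_nonneg.2 (pow_le_pow_left₀ hL (hLu i) 2)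
  have hort : Pairwise fun i j => inner ℂ (u i) (u j) = 0 := fun i j hij => hu.inner_eq_zero hij
  have hk : inner ℂ (u k) (c.sum fun i a => a • u i) = c k := by
    simpa [Finsupp.linearCombination_apply] using hu.inner_right_finsupp c k
  rw [Set.mem_ofPred_eq, hk, Finsupp.sum, map_sum]
  simp only [map_smul]
  rw [norm_sq_sum_smul_of_pairwise_inner_eq_zero hTu,
    norm_sq_sum_smul_of_pairwise_inner_eq_zero hort, Finset.mul_sum, ← Finset.sum_sub_distrib]
  have hterm (i : ι) : ‖c i‖ ^ 2 * ‖T (u i)‖ ^ 2 - L ^ 2 * (‖c i‖ ^ 2 * ‖u i‖ ^ 2) =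
      ‖c i‖ ^ 2 * (‖T (u i)‖ ^ 2 - L ^ 2) := by
    rw [hu.norm_eq_one i]; ring
  simp only [hterm]
  by_cases hkc : k ∈ c.support
  · exact Finset.single_le_sum (f := fun i => ‖c i‖ ^ 2 * (‖T (u i)‖ ^ 2 - L ^ 2))
      (fun i _ => mul_nonneg (sq_nonneg _) (hsq i)) hkc
  · rw [Finsupp.notMem_support_iff.1 hkc]
    simpa using Finset.sum_nonneg fun i _ => mul_nonneg (sq_nonneg _) (hsq i)

/-- An operator mapping an orthonormal sequence to pairwise orthogonal vectors of strictly
decreasing norms does not attain its minimum on the closed span of the sequence. -/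
theorem not_isAbsMinAttaining_of_strictAnti {T : E →L[ℂ] F} {u : ℕ → E} (hu : Orthonormal ℂ u)
    (hTu : Pairwise fun i j => inner ℂ (T (u i)) (T (u j)) = 0)
    (hanti : StrictAnti fun n => ‖T (u n)‖) : ¬ IsAbsMinAttaining T := by
  intro hT
  set M := (Submodule.span ℂ (Set.range u)).topologicalClosure
  have huM (n : ℕ) : u n ∈ M :=
    Submodule.le_topologicalClosure _ (Submodule.subset_span ⟨n, rfl⟩)
  have hMbot : M ≠ ⊥ := fun h => hu.ne_zero 0 ((Submodule.eq_bot_iff _).1 h _ (huM 0))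
  obtain ⟨x, hx1, hx⟩ := hT M (Submodule.isClosed_topologicalClosure _) hMbot
  set L := minModulus (T.comp M.subtypeL)
  have hL : 0 ≤ L := minModulus_nonneg _
  have hLu (n : ℕ) : L ≤ ‖T (u n)‖ :=
    minModulus_le (T.comp M.subtypeL) (x := ⟨u n, huM n⟩) (hu.norm_eq_one n)
  have hx1' : ‖(x : E)‖ = 1 := hx1
  have hTx : ‖T (x : E)‖ = L := hx
  -- At the minimiser the right side of the coordinate inequality is zero, while strict decrease
  -- makes the factor on the left positive.
  have hcoef (k : ℕ) : inner ℂ (u k) (x : E) = 0 := by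
    have h := norm_sq_inner_mul_le_of_mem_closure_span T hu hTu hL hLu k x.2
    rw [hx1', hTx] at h
    have hlt : L < ‖T (u k)‖ := (hLu (k + 1)).trans_lt (hanti k.lt_succ_self)
    have hpos : 0 < ‖T (u k)‖ ^ 2 - L ^ 2 := sub_pos.2 (pow_lt_pow_left₀ hlt hL two_ne_zero)
    by_contra hne
    have := mul_pos (pow_pos (norm_pos_iff.2 hne) 2) hpos
    linarith
  have hperp : (x : E) ∈ (Submodule.span ℂ (Set.range u)).topologicalClosureᗮ := by
    rw [Submodule.orthogonal_closure, Submodule.mem_orthogonal]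
    intro y hy
    induction hy using Submodule.span_induction with
    | mem y hy => obtain ⟨n, rfl⟩ := hy; exact hcoef n
    | zero => simp
    | add y z _ _ hy hz => rw [inner_add_left, hy, hz, add_zero]
    | smul a y _ hy => rw [inner_smul_left, hy, mul_zero]
  have h0 : (x : E) = 0 := inner_self_eq_zero.1 (hperp (x : E) x.2)
  rw [h0, norm_zero] at hx1'
  exact zero_ne_one hx1'

end

/-! ### Existence of an eigenbasis -/

section Hilbert

variable {H : Type*} [NormedAddCommGroup H] [InnerProductSpace ℂ H] [CompleteSpace H]

/-- A vector at which `‖T x‖` is minimal on the unit sphere is an eigenvector of `T† T`. -/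
theorem exists_adjoint_apply_eq_smul_of_norm_eq_minModulus {K : Type*} [NormedAddCommGroup K]
    [InnerProductSpace ℂ K] [CompleteSpace K] (S : K →L[ℂ] H) {x : K} (hx : ‖x‖ = 1)
    (hSx : ‖S x‖ = minModulus S) :
    S.adjoint (S x) = ((‖S x‖ ^ 2 : ℝ) : ℂ) • x := by
  have hsa : IsSelfAdjoint (S.adjoint ∘L S) := by
    rw [isSelfAdjoint_iff, ContinuousLinearMap.star_eq_adjoint, ContinuousLinearMap.adjoint_comp,
      ContinuousLinearMap.adjoint_adjoint]
  have happ (y : K) : (S.adjoint ∘L S).reApplyInnerSelf y = ‖S y‖ ^ 2 := by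
    rw [ContinuousLinearMap.reApplyInnerSelf_apply, ContinuousLinearMap.comp_apply,
      ContinuousLinearMap.adjoint_inner_left, inner_self_eq_norm_sq]
  have hmin : IsMinOn (S.adjoint ∘L S).reApplyInnerSelf (Metric.sphere (0 : K) ‖x‖) x := by
    intro y hy
    rw [mem_sphere_zero_iff_norm, hx] at hy
    rw [Set.mem_ofPred_eq, happ, happ, hSx]
    exact pow_le_pow_left₀ (minModulus_nonneg S) (minModulus_le S hy) 2
  have h := hsa.eq_smul_self_of_isLocalExtrOn (Or.inl hmin.localize)
  rw [ContinuousLinearMap.rayleighQuotient, happ, hx] at h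
  simpa using h

/-- A positive absolutely minimum attaining operator has an eigenvector in each nonzero
closed invariant subspace. -/
theorem IsAbsMinAttaining.exists_eigenvector_mem {T : H →L[ℂ] H} (hT : IsAbsMinAttaining T)
    (hpos : T.IsPositive) {M : Submodule ℂ H} (hM : IsClosed (M : Set H)) (hMbot : M ≠ ⊥)
    (hinv : ∀ x ∈ M, T x ∈ M) :
    ∃ x ∈ M, ‖x‖ = 1 ∧ ∃ m : ℝ, 0 ≤ m ∧ T x = (m : ℂ) • x := by
  have : CompleteSpace M := hM.completeSpace_coe
  obtain ⟨x, hx1, hx⟩ := hT M hM hMbot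
  have hadj := exists_adjoint_apply_eq_smul_of_norm_eq_minModulus _ hx1 hx
  set m := ‖(T.comp M.subtypeL) x‖ with hm
  have hsym := hpos.isSelfAdjoint.isSymmetric
  have hsq : T (T x) = ((m ^ 2 : ℝ) : ℂ) • (x : H) := by
    -- The adjoint of the restriction only controls inner products against `M`; invariance of `M`
    -- makes that enough.
    have h (y : M) : inner ℂ (T (T x) - ((m ^ 2 : ℝ) : ℂ) • (x : H)) (y : H) = 0 := by
      have h1 := congrArg (fun z : M => inner ℂ z y) hadj
      simp only [ContinuousLinearMap.adjoint_inner_left] at h1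
      rw [inner_sub_left, sub_eq_zero]
      have h2 : inner ℂ (T (T x)) (y : H) = inner ℂ (T x) (T y) := hsym _ _
      rw [h2]
      exact h1
    have hmem : T (T x) - ((m ^ 2 : ℝ) : ℂ) • (x : H) ∈ M :=
      M.sub_mem (hinv _ (hinv _ x.2)) (M.smul_mem _ x.2)
    exact sub_eq_zero.1 (inner_self_eq_zero.1 (h ⟨_, hmem⟩))
  refine ⟨x, x.2, hx1, m, norm_nonneg _, ?_⟩
  have hm0 : 0 ≤ m := norm_nonneg _
  rcases hm0.eq_or_lt with h0 | h0
  · have hTx : T x = 0 := norm_eq_zero.1 (hm.symm.trans h0.symm)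
    rw [hTx, ← h0, Complex.ofReal_zero, zero_smul]
  -- Factor `T ^ 2 - m ^ 2 = (T + m) (T - m)`: a nonzero `y` would be an eigenvector for `-m < 0`.
  · set y := T x - (m : ℂ) • (x : H) with hy
    have hTy : T y = -((m : ℂ) • y) := by
      rw [hy, map_sub, map_smul, hsq, smul_sub, smul_smul]
      push_cast
      rw [sq]
      abel
    have h1 : 0 ≤ RCLike.re (inner ℂ (T y) y) := hpos.re_inner_nonneg_left y
    rw [hTy, inner_neg_left, inner_smul_left, inner_self_eq_norm_sq_to_K] at h1
    have h2 : RCLike.re (-((starRingEnd ℂ) (m : ℂ) * ((‖y‖ : ℝ) : ℂ) ^ 2)) = -(m * ‖y‖ ^ 2) := by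
      rw [Complex.conj_ofReal, ← Complex.ofReal_pow, ← Complex.ofReal_mul, ← Complex.ofReal_neg]
      exact Complex.ofReal_re _
    have h3 : 0 ≤ -(m * ‖y‖ ^ 2) := h2 ▸ h1
    have h4 : ‖y‖ ^ 2 = 0 := by
      by_contra hne
      have := mul_pos h0 ((sq_nonneg ‖y‖).lt_of_ne' hne)
      linarith
    exact sub_eq_zero.1 (norm_eq_zero.1 (pow_eq_zero_iff two_ne_zero |>.1 h4))

/-- A positive absolutely minimum attaining operator is diagonal in some Hilbert basis. -/
theorem IsAbsMinAttaining.exists_hilbertBasis_eigenvectors {T : H →L[ℂ] H}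
    (hT : IsAbsMinAttaining T) (hpos : T.IsPositive) :
    ∃ (Λ : Set H) (v : HilbertBasis Λ ℂ H) (μ : Λ → ℝ),
      (∀ α, 0 ≤ μ α) ∧ ∀ α, T (v α) = (μ α : ℂ) • v α := by
  obtain ⟨Λ, hΛ⟩ := zorn_subset {b : Set H | Orthonormal ℂ (Subtype.val : b → H) ∧
      ∀ x ∈ b, ∃ m : ℝ, 0 ≤ m ∧ T x = (m : ℂ) • x} (by
    intro c hc hchain
    refine ⟨⋃₀ c, ⟨orthonormal_sUnion_of_directed hchain.directedOn fun s hs => (hc hs).1, ?_⟩,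
      fun _ => Set.subset_sUnion_of_mem⟩
    rintro x ⟨s, hs, hxs⟩
    exact (hc hs).2 x hxs)
  obtain ⟨⟨hort, heig⟩, hmax⟩ := hΛ
  have hbot : (Submodule.span ℂ (Set.range (Subtype.val : Λ → H)))ᗮ = ⊥ := by
    rw [Subtype.range_coe]
    by_contra hne
    have hmem (x : H) : x ∈ (Submodule.span ℂ Λ)ᗮ ↔ ∀ y ∈ Λ, inner ℂ y x = 0 := by
      refine ⟨fun h y hy => h y (Submodule.subset_span hy), fun h y hy => ?_⟩
      induction hy using Submodule.span_induction with
      | mem y hy => exact h y hy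
      | zero => simp
      | add y z _ _ hy hz => rw [inner_add_left, hy, hz, add_zero]
      | smul a y _ hy => rw [inner_smul_left, hy, mul_zero]
    obtain ⟨x, hx, hx1, m, hm, hTx⟩ := hT.exists_eigenvector_mem hpos
      (Submodule.isClosed_orthogonal _) hne (fun x hx => by
        rw [hmem] at hx ⊢
        intro y hy
        obtain ⟨m, -, hTy⟩ := heig y hy
        have h : inner ℂ (T y) x = inner ℂ y (T x) := hpos.isSelfAdjoint.isSymmetric y x
        rw [← h, hTy, inner_smul_left, hx y hy, mul_zero])
    rw [hmem] at hx
    have hxΛ : x ∉ Λ := fun h => by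
      have := hx x h
      rw [inner_self_eq_zero] at this
      rw [this, norm_zero] at hx1
      exact zero_ne_one hx1
    refine hxΛ (hmax (y := insert x Λ) ⟨?_, ?_⟩ (Set.subset_insert _ _) (Set.mem_insert _ _))
    · refine ⟨fun y => ?_, fun y z hyz => ?_⟩
      · rcases y with ⟨y, rfl | hy⟩
        · exact hx1
        · exact hort.1 ⟨y, hy⟩
      · rcases y with ⟨y, rfl | hy⟩ <;> rcases z with ⟨z, rfl | hz⟩
        · exact absurd rfl hyz
        · exact inner_eq_zero_symm.1 (hx z hz)
        · exact hx y hy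
        · exact hort.2 (i := ⟨y, hy⟩) (j := ⟨z, hz⟩) fun h => hyz (Subtype.ext (Subtype.mk.inj h))
    · rintro y (rfl | hy)
      · exact ⟨m, hm, hTx⟩
      · exact heig y hy
  choose μ hμ hTμ using fun α : Λ => heig α α.2
  refine ⟨Λ, HilbertBasis.mkOfOrthogonalEqBot hort hbot, μ, hμ, fun α => ?_⟩
  rw [HilbertBasis.coe_mkOfOrthogonalEqBot]
  exact hTμ α

end Hilbert

/-! ### Constraints on the eigenvalues -/

section Diagonal

variable {H : Type*} [NormedAddCommGroup H] [InnerProductSpace ℂ H] {ι : Type*}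

theorem Orthonormal.inner_smul_add_smul_of_ne {v : ι → H} (hv : Orthonormal ℂ v) {a b : ℕ → ι}
    (ha : Function.Injective a) (hb : Function.Injective b) (hab : ∀ m n, a m ≠ b n)
    (p q : ℕ → ℂ) {m n : ℕ} (hmn : m ≠ n) :
    inner ℂ (p m • v (a m) + q m • v (b m)) (p n • v (a n) + q n • v (b n)) = 0 := by
  simp only [inner_add_left, inner_add_right, inner_smul_left, inner_smul_right,
    hv.inner_eq_zero (ha.ne hmn), hv.inner_eq_zero (hb.ne hmn), hv.inner_eq_zero (hab m n),
    hv.inner_eq_zero (hab n m).symm, mul_zero, add_zero]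

theorem Orthonormal.norm_sq_smul_add_smul {v : ι → H} (hv : Orthonormal ℂ v) {i j : ι}
    (hij : i ≠ j) (p q : ℂ) : ‖p • v i + q • v j‖ ^ 2 = ‖p‖ ^ 2 + ‖q‖ ^ 2 := by
  rw [sq, norm_add_sq_eq_norm_sq_add_norm_sq_of_inner_eq_zero (𝕜 := ℂ), norm_smul, norm_smul,
    hv.norm_eq_one, hv.norm_eq_one]
  · ring
  · rw [inner_smul_left, inner_smul_right, hv.inner_eq_zero hij, mul_zero, mul_zero]

variable {T : H →L[ℂ] H} {v : ι → H} {μ : ι → ℝ}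

/-- Two sequences of eigenvectors whose eigenvalues are separated can be mixed into an orthonormal
sequence with strictly decreasing image norms. -/
theorem not_isAbsMinAttaining_of_separated (hv : Orthonormal ℂ v) (hμ : ∀ α, 0 ≤ μ α)
    (hTv : ∀ α, T (v α) = (μ α : ℂ) • v α) {A B : ℝ} (hAB : A < B) {a b : ℕ → ι}
    (ha : Function.Injective a) (hb : Function.Injective b) (haA : ∀ n, μ (a n) ≤ A)
    (hbB : ∀ n, B ≤ μ (b n)) : ¬ IsAbsMinAttaining T := by
  have hab (m n : ℕ) : a m ≠ b n := fun h => by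
    have := (h ▸ haA m).trans_lt (hAB.trans_le (hbB n))
    exact lt_irrefl _ this
  have hA : 0 ≤ A := (hμ _).trans (haA 0)
  have hAB2 : A ^ 2 < B ^ 2 := pow_lt_pow_left₀ hAB hA two_ne_zero
  -- Prescribed values of `‖T (u n)‖ ^ 2`, strictly decreasing inside `[A ^ 2, B ^ 2]`.
  set g : ℕ → ℝ := fun n => A ^ 2 + (B ^ 2 - A ^ 2) / (n + 1) with hg
  have hgA (n : ℕ) : A ^ 2 ≤ g n :=
    le_add_of_nonneg_right (div_nonneg (sub_nonneg.2 hAB2.le) (by positivity))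
  have hgB (n : ℕ) : g n ≤ B ^ 2 := by
    have : (B ^ 2 - A ^ 2) / ((n : ℝ) + 1) ≤ B ^ 2 - A ^ 2 :=
      div_le_self (sub_nonneg.2 hAB2.le) (by simp)
    simp only [hg]
    linarith
  have hganti : StrictAnti g := fun m n hmn => by
    have hmn' : (m : ℝ) < n := by exact_mod_cast hmn
    refine add_lt_add_right (div_lt_div_of_pos_left (sub_pos.2 hAB2) (by positivity) ?_) _
    linarith
  have haA2 (n : ℕ) : μ (a n) ^ 2 ≤ A ^ 2 := pow_le_pow_left₀ (hμ _) (haA n) 2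
  have hbB2 (n : ℕ) : B ^ 2 ≤ μ (b n) ^ 2 := pow_le_pow_left₀ (hA.trans hAB.le) (hbB n) 2
  set D : ℕ → ℝ := fun n => μ (b n) ^ 2 - μ (a n) ^ 2 with hD
  have hDpos (n : ℕ) : 0 < D n := by
    simp only [hD]
    linarith [haA2 n, hbB2 n]
  -- The weights solve `p ^ 2 + q ^ 2 = 1` and `p ^ 2 * μ (a n) ^ 2 + q ^ 2 * μ (b n) ^ 2 = g n`.
  set p : ℕ → ℝ := fun n => √((μ (b n) ^ 2 - g n) / D n)
  set q : ℕ → ℝ := fun n => √((g n - μ (a n) ^ 2) / D n)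
  have hp (n : ℕ) : p n ^ 2 = (μ (b n) ^ 2 - g n) / D n :=
    Real.sq_sqrt (div_nonneg (by linarith [hgB n, hbB2 n]) (hDpos n).le)
  have hq (n : ℕ) : q n ^ 2 = (g n - μ (a n) ^ 2) / D n :=
    Real.sq_sqrt (div_nonneg (by linarith [hgA n, haA2 n]) (hDpos n).le)
  set u : ℕ → H := fun n => (p n : ℂ) • v (a n) + (q n : ℂ) • v (b n) with hu
  have hTu (n : ℕ) : T (u n) =
      ((p n * μ (a n) : ℝ) : ℂ) • v (a n) + ((q n * μ (b n) : ℝ) : ℂ) • v (b n) := by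
    simp only [hu, map_add, map_smul, hTv, smul_smul, Complex.ofReal_mul]
  have hnorm (n : ℕ) : ‖u n‖ = 1 := by
    have h : ‖u n‖ ^ 2 = 1 := by
      simp only [hu]
      rw [hv.norm_sq_smul_add_smul (hab n n), Complex.norm_real, Complex.norm_real,
        Real.norm_eq_abs, Real.norm_eq_abs, sq_abs, sq_abs, hp, hq, ← add_div,
        div_eq_one_iff_eq (hDpos n).ne']
      simp only [hD]
      ring
    exact (pow_eq_one_iff_of_nonneg (norm_nonneg _) two_ne_zero).1 h
  have hTnorm (n : ℕ) : ‖T (u n)‖ ^ 2 = g n := by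
    rw [hTu, hv.norm_sq_smul_add_smul (hab n n), Complex.norm_real, Complex.norm_real,
      Real.norm_eq_abs, Real.norm_eq_abs, sq_abs, sq_abs, mul_pow, mul_pow, hp, hq]
    have := (hDpos n).ne'
    field_simp
    simp only [hD]
    ring
  refine not_isAbsMinAttaining_of_strictAnti (u := u)
    ⟨hnorm, fun m n hmn => hv.inner_smul_add_smul_of_ne ha hb hab
      (fun n => (p n : ℂ)) (fun n => (q n : ℂ)) hmn⟩ (fun m n hmn => ?_)
    fun m n hmn => ?_
  · simp only [hTu]
    exact hv.inner_smul_add_smul_of_ne ha hb hab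
      (fun n => ((p n * μ (a n) : ℝ) : ℂ)) (fun n => ((q n * μ (b n) : ℝ) : ℂ)) hmn
  · refine lt_of_pow_lt_pow_left₀ 2 (norm_nonneg _) ?_
    rw [hTnorm, hTnorm]
    exact hganti hmn

/-- The eigenvalues of an absolutely minimum attaining diagonal operator cannot accumulate on both
sides of a gap. -/
theorem IsAbsMinAttaining.finite_or_finite (hT : IsAbsMinAttaining T) (hv : Orthonormal ℂ v)
    (hμ : ∀ α, 0 ≤ μ α) (hTv : ∀ α, T (v α) = (μ α : ℂ) • v α) {A B : ℝ} (hAB : A < B) :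
    {α | μ α ≤ A}.Finite ∨ {α | B ≤ μ α}.Finite := by
  by_contra h
  obtain ⟨hA, hB⟩ := not_or.1 h
  let a := Set.Infinite.natEmbedding _ hA
  let b := Set.Infinite.natEmbedding _ hB
  exact not_isAbsMinAttaining_of_separated hv hμ hTv hAB
    (a := fun n => (a n : ι)) (b := fun n => (b n : ι))
    (Subtype.val_injective.comp a.injective) (Subtype.val_injective.comp b.injective)
    (fun n => (a n).2) (fun n => (b n).2) hT

/-- The eigenvalues of an absolutely minimum attaining diagonal operator are well-ordered. -/
theorem IsAbsMinAttaining.wellFounded_eigenvalues (hT : IsAbsMinAttaining T)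
    (hv : Orthonormal ℂ v) (hμ : ∀ α, 0 ≤ μ α) (hTv : ∀ α, T (v α) = (μ α : ℂ) • v α) :
    WellFounded fun α β => μ α < μ β := by
  refine wellFounded_iff_isEmpty_descending_chain.2 ⟨fun ⟨f, hf⟩ => ?_⟩
  have hanti : StrictAnti fun n => μ (f n) := strictAnti_nat_of_succ_lt hf
  have hinj : Function.Injective f := fun m n h => hanti.injective (congrArg μ h)
  refine not_isAbsMinAttaining_of_strictAnti (T := T) (hv.comp f hinj) (fun m n hmn => ?_) ?_ hT
  · simp only [Function.comp_apply, hTv, inner_smul_left, inner_smul_right,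
      hv.inner_eq_zero (hinj.ne hmn), mul_zero]
  · have h (n : ℕ) : ‖T ((v ∘ f) n)‖ = μ (f n) := by
      rw [Function.comp_apply, hTv, norm_smul, hv.norm_eq_one, Complex.norm_real,
        Real.norm_of_nonneg (hμ _), mul_one]
    simpa only [h] using hanti

end Diagonal

/-! ### Eigenvalues and spectrum of a diagonal operator -/

section HilbertBasisDiagonal

variable {H : Type*} [NormedAddCommGroup H] [InnerProductSpace ℂ H] {ι : Type*}
  {T : H →L[ℂ] H} {v : HilbertBasis ι ℂ H} {μ : ι → ℝ}

theorem HilbertBasis.eq_zero_of_forall_inner_eq_zero (v : HilbertBasis ι ℂ H) {x : H}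
    (h : ∀ α, inner ℂ (v α) x = 0) : x = 0 := by
  refine v.repr.injective ?_
  ext α
  simp [HilbertBasis.repr_apply_apply, h α]

theorem HilbertBasis.hasSum_diagonal (hTv : ∀ α, T (v α) = (μ α : ℂ) • v α) (x : H) :
    HasSum (fun α => (μ α : ℂ) • InnerProductSpace.rankOne ℂ (v α) (v α) x) (T x) := by
  refine ((v.hasSum_repr x).mapL T).congr_fun fun α => ?_
  rw [map_smul, hTv, HilbertBasis.repr_apply_apply, InnerProductSpace.rankOne_apply, smul_comm]

theorem HilbertBasis.inner_diagonal (hTv : ∀ α, T (v α) = (μ α : ℂ) • v α)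
    (hsym : (T : H →ₗ[ℂ] H).IsSymmetric) (α : ι) (x : H) :
    inner ℂ (v α) (T x) = μ α * inner ℂ (v α) x := by
  have h : inner ℂ (T (v α)) x = inner ℂ (v α) (T x) := hsym _ _
  rw [← h, hTv, inner_smul_left, Complex.conj_ofReal]

theorem HilbertBasis.hasEigenvalue_diagonal (hTv : ∀ α, T (v α) = (μ α : ℂ) • v α) (α : ι) :
    Module.End.HasEigenvalue (T : H →ₗ[ℂ] H) (μ α : ℂ) :=
  Module.End.hasEigenvalue_of_hasEigenvector
    ⟨Module.End.mem_eigenspace_iff.2 (hTv α), v.orthonormal.ne_zero α⟩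

/-- An eigenvector is orthogonal to the basis vectors belonging to other eigenvalues. -/
theorem HilbertBasis.inner_eq_zero_of_mem_eigenspace (hTv : ∀ α, T (v α) = (μ α : ℂ) • v α)
    (hsym : (T : H →ₗ[ℂ] H).IsSymmetric) {z : ℂ} {x : H}
    (hx : x ∈ Module.End.eigenspace (T : H →ₗ[ℂ] H) z) {α : ι} (hα : (μ α : ℂ) ≠ z) :
    inner ℂ (v α) x = 0 := by
  have h := HilbertBasis.inner_diagonal hTv hsym α x
  have hTx : T x = z • x := Module.End.mem_eigenspace_iff.1 hx
  rw [hTx, inner_smul_right] at h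
  by_contra hne
  exact hα (mul_right_cancel₀ hne h).symm

theorem HilbertBasis.setOf_hasEigenvalue_diagonal (hTv : ∀ α, T (v α) = (μ α : ℂ) • v α)
    (hsym : (T : H →ₗ[ℂ] H).IsSymmetric) :
    {z : ℂ | Module.End.HasEigenvalue (T : H →ₗ[ℂ] H) z} = Set.range fun α => (μ α : ℂ) := by
  refine Set.Subset.antisymm (fun z hz => ?_) ?_
  · obtain ⟨x, hx⟩ := Module.End.HasEigenvalue.exists_hasEigenvector hz
    by_contra hne
    exact hx.2 (v.eq_zero_of_forall_inner_eq_zero fun α =>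
      HilbertBasis.inner_eq_zero_of_mem_eigenspace hTv hsym hx.1 fun h => hne ⟨α, h⟩)
  · rintro _ ⟨α, rfl⟩
    exact HilbertBasis.hasEigenvalue_diagonal hTv α

/-- If only finitely many indices carry `z`, the basis expansion of each eigenvector is a finite sum
over them. -/
theorem HilbertBasis.infinite_of_not_finiteDimensional_eigenspace
    (hTv : ∀ α, T (v α) = (μ α : ℂ) • v α) (hsym : (T : H →ₗ[ℂ] H).IsSymmetric) {z : ℂ}
    (hz : ¬ FiniteDimensional ℂ (Module.End.eigenspace (T : H →ₗ[ℂ] H) z)) :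
    {α | (μ α : ℂ) = z}.Infinite := by
  intro hfin
  refine hz ?_
  set W := Submodule.span ℂ (v '' {α | (μ α : ℂ) = z})
  have hW : FiniteDimensional ℂ W := FiniteDimensional.span_of_finite ℂ (hfin.image _)
  refine Submodule.finiteDimensional_of_le (S₂ := W) fun x hx => ?_
  have hsum := v.hasSum_repr x
  have h : HasSum (fun α => v.repr x α • v α) (∑ α ∈ hfin.toFinset, v.repr x α • v α) :=
    hasSum_sum_of_ne_finset_zero fun α hα => by
      rw [HilbertBasis.repr_apply_apply,
        HilbertBasis.inner_eq_zero_of_mem_eigenspace hTv hsym hx (by simpa using hα), zero_smul]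
  rw [hsum.unique h]
  refine Submodule.sum_mem _ fun α hα => W.smul_mem _ (Submodule.subset_span ⟨α, ?_, rfl⟩)
  simpa using hα

/-- Off the closure, `z - T` is bounded below by the distance `δ` to the eigenvalues, so its range
is closed; it contains the basis, hence is everything. -/
theorem HilbertBasis.spectrum_diagonal [CompleteSpace H]
    (hTv : ∀ α, T (v α) = (μ α : ℂ) • v α) :
    spectrum ℂ T = closure (Set.range fun α => (μ α : ℂ)) := by
  refine Set.Subset.antisymm (fun z hz => ?_) ?_
  · by_contra hcl
    refine hz ?_
    obtain ⟨δ, hδ, hball⟩ := Metric.mem_nhds_iff.1 (isClosed_closure.isOpen_compl.mem_nhds hcl)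
    have hdist (α : ι) : δ ≤ ‖z - μ α‖ := by
      by_contra hlt
      refine hball (a := (μ α : ℂ)) ?_ (subset_closure ⟨α, rfl⟩)
      rw [Metric.mem_ball, dist_comm, dist_eq_norm]
      exact not_le.1 hlt
    set S : H →L[ℂ] H := algebraMap ℂ (H →L[ℂ] H) z - T with hS
    have hSv (α : ι) : S (v α) = (z - μ α) • v α := by
      rw [hS, _root_.sub_apply, hTv, sub_smul, Algebra.algebraMap_eq_smul_one]
      rfl
    have hbound (x : H) : δ * ‖x‖ ≤ ‖S x‖ := by
      rcases isEmpty_or_nonempty ι with hι | ⟨⟨k⟩⟩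
      · rw [v.eq_zero_of_forall_inner_eq_zero (x := x) fun α => isEmptyElim α]
        simp
      · have hSnorm (α : ι) : δ ≤ ‖S (v α)‖ := by
          rw [hSv, norm_smul, v.orthonormal.norm_eq_one, mul_one]
          exact hdist α
        have h := norm_sq_inner_mul_le_of_mem_closure_span S v.orthonormal
          (fun i j hij => by
            simp only [hSv, inner_smul_left, inner_smul_right, v.orthonormal.inner_eq_zero hij,
              mul_zero]) hδ.le hSnorm k (x := x) (by rw [v.dense_span]; trivial)
        have h0 : 0 ≤ ‖inner ℂ (v k) x‖ ^ 2 * (‖S (v k)‖ ^ 2 - δ ^ 2) :=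
          mul_nonneg (sq_nonneg _) (sub_nonneg.2 (pow_le_pow_left₀ hδ.le (hSnorm k) 2))
        refine (pow_le_pow_iff_left₀ (by positivity) (norm_nonneg _) two_ne_zero).1 ?_
        rw [mul_pow]
        linarith
    have hanti : AntilipschitzWith (Real.toNNReal δ⁻¹) S :=
      S.antilipschitz_of_bound fun x => by
        rw [Real.coe_toNNReal _ (inv_nonneg.2 hδ.le), ← div_eq_inv_mul, le_div_iff₀ hδ, mul_comm]
        exact hbound x
    refine ContinuousLinearMap.isUnit_iff_bijective.2 ⟨hanti.injective, ?_⟩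
    have hclosed : IsClosed ((S : H →ₗ[ℂ] H).range : Set H) :=
      hanti.isClosed_range S.uniformContinuous
    have hle : Submodule.span ℂ (Set.range v) ≤ (S : H →ₗ[ℂ] H).range := by
      rw [Submodule.span_le]
      rintro _ ⟨α, rfl⟩
      have hne : z - μ α ≠ 0 := norm_pos_iff.1 (hδ.trans_le (hdist α))
      refine ⟨(z - μ α)⁻¹ • v α, ?_⟩
      change S _ = _
      rw [map_smul, hSv, inv_smul_smul₀ hne]
    have htop := Submodule.topologicalClosure_minimal _ hle hclosed
    rw [v.dense_span] at htop
    exact LinearMap.range_eq_top.1 (top_le_iff.1 htop)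
  · refine closure_minimal ?_ (spectrum.isClosed T)
    rintro _ ⟨α, rfl⟩ hu
    have hinj := (ContinuousLinearMap.isUnit_iff_bijective.1 hu).1
    refine v.orthonormal.ne_zero α (hinj ?_)
    rw [map_zero, _root_.sub_apply, hTv, Algebra.algebraMap_eq_smul_one]
    exact sub_self _

end HilbertBasisDiagonal

/-! ### Well-ordered families of reals and their limit points -/

section RealFamily

variable {ι : Type*} {μ : ι → ℝ}

/-- The values exceeding `l`, if any, have a least element. -/
theorem exists_gap_above (hwf : WellFounded fun α β => μ α < μ β) (l : ℝ) :
    ∃ ε > 0, ∀ α, μ α ≤ l ∨ l + ε ≤ μ α := by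
  by_cases hne : {α | l < μ α}.Nonempty
  · obtain ⟨α, hα, hmin⟩ := hwf.has_min _ hne
    refine ⟨μ α - l, sub_pos.2 hα, fun β => ?_⟩
    rcases le_or_gt (μ β) l with h | h
    · exact Or.inl h
    · rw [add_sub_cancel]
      exact Or.inr (not_lt.1 (hmin β h))
  · exact ⟨1, one_pos, fun α => Or.inl (not_lt.1 fun h => hne ⟨α, h⟩)⟩

theorem countable_range_of_wellFounded (hwf : WellFounded fun α β => μ α < μ β) :
    (Set.range μ).Countable := by
  -- The gap above each value isolates it from the right, and a set of reals has only countably many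
  -- such points.
  refine (countable_setOfPred_isolated_right_within (s := Set.range μ)).mono ?_
  intro x hx
  refine ⟨hx, ?_⟩
  obtain ⟨ε, hε, hgap⟩ := exists_gap_above hwf x
  rw [← empty_mem_iff_bot]
  refine mem_nhdsWithin.2 ⟨Set.Iio (x + ε), isOpen_Iio, lt_add_of_pos_right x hε, ?_⟩
  rintro _ ⟨hlt, ⟨α, rfl⟩, hgt⟩
  rcases hgap α with h | h
  · exact absurd hgt (not_lt.2 h)
  · exact absurd hlt (not_lt.2 h)

theorem isLeast_sInf_image_of_wellFounded (hwf : WellFounded fun α β => μ α < μ β) {Γ : Set ι}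
    (hΓ : Γ.Nonempty) : IsLeast (μ '' Γ) (sInf (μ '' Γ)) := by
  obtain ⟨α, hα, hmin⟩ := hwf.has_min _ hΓ
  have hleast : IsLeast (μ '' Γ) (μ α) :=
    ⟨⟨α, hα, rfl⟩, by rintro _ ⟨β, hβ, rfl⟩; exact not_lt.1 (hmin β hβ)⟩
  rwa [hleast.csInf_eq]

theorem exists_ofReal_eq_of_accPt_closure_range {z : ℂ}
    (hz : AccPt z (𝓟 (closure (Set.range fun α => (μ α : ℂ))))) :
    ∃ l : ℝ, z = l ∧ ∀ ε > 0, ∃ α, μ α ≠ l ∧ |μ α - l| < ε := by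
  have hclosed : IsClosed (Set.range ((↑) : ℝ → ℂ)) :=
    Complex.isometry_ofReal.isClosedEmbedding.isClosed_range
  have hsub : closure (Set.range fun α => (μ α : ℂ)) ⊆ Set.range ((↑) : ℝ → ℂ) :=
    closure_minimal (by rintro _ ⟨α, rfl⟩; exact ⟨μ α, rfl⟩) hclosed
  obtain ⟨l, rfl⟩ := hsub (isClosed_iff_accPt.1 isClosed_closure z hz)
  refine ⟨l, rfl, fun ε hε => ?_⟩
  obtain ⟨y, ⟨hyball, hycl⟩, hy⟩ := accPt_iff_nhds.1 hz _ (Metric.ball_mem_nhds _ hε)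
  obtain ⟨_, ⟨hball, hne⟩, α, rfl⟩ := mem_closure_iff.1 hycl (Metric.ball (l : ℂ) ε ∩ {(l : ℂ)}ᶜ)
    (Metric.isOpen_ball.inter isOpen_compl_singleton) ⟨hyball, hy⟩
  refine ⟨α, fun h => hne (by simp [h]), ?_⟩
  rwa [Metric.mem_ball, dist_eq_norm, ← Complex.ofReal_sub, Complex.norm_real] at hball

theorem infinite_setOf_abs_sub_lt {l : ℝ} (hl : ∀ ε > 0, ∃ α, μ α ≠ l ∧ |μ α - l| < ε)
    {ε : ℝ} (hε : 0 < ε) : {α | |μ α - l| < ε}.Infinite := by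
  intro hfin
  -- Finitely many values other than `l` stay at a positive distance from `l`.
  have hmem : ((μ '' {α | |μ α - l| < ε}) \ {l})ᶜ ∈ 𝓝 l :=
    (hfin.image μ).sdiff.isClosed.isOpen_compl.mem_nhds fun h => h.2 rfl
  obtain ⟨δ, hδ, hball⟩ := Metric.mem_nhds_iff.1 hmem
  obtain ⟨α, hne, hα⟩ := hl (min δ ε) (lt_min hδ hε)
  exact hball (a := μ α) (hα.trans_le (min_le_left _ _))
    ⟨⟨α, hα.trans_le (min_le_right _ _), rfl⟩, hne⟩

/-- If no gap has infinitely many members on both sides, there is at most one point with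
infinitely many members in each of its neighbourhoods. -/
theorem eq_of_infinite_setOf_abs_sub_lt
    (hgap : ∀ A B : ℝ, A < B → {α | μ α ≤ A}.Finite ∨ {α | B ≤ μ α}.Finite) {l l' : ℝ}
    (hl : ∀ ε > 0, {α | |μ α - l| < ε}.Infinite) (hl' : ∀ ε > 0, {α | |μ α - l'| < ε}.Infinite) :
    l = l' := by
  wlog hlt : l < l' generalizing l l'
  · rcases (not_lt.1 hlt).eq_or_lt with h | h
    · exact h.symm
    · exact (this hl' hl h).symm
  have hε : 0 < (l' - l) / 3 := by linarith
  rcases hgap (l + (l' - l) / 3) (l' - (l' - l) / 3) (by linarith) with h | h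
  · refine absurd (h.subset fun α hα => ?_) (hl _ hε)
    have hlt : |μ α - l| < (l' - l) / 3 := hα
    have := abs_lt.1 hlt
    change μ α ≤ _
    linarith
  · refine absurd (h.subset fun α hα => ?_) (hl' _ hε)
    have hlt : |μ α - l'| < (l' - l) / 3 := hα
    have := abs_lt.1 hlt
    change _ ≤ μ α
    linarith

theorem exists_strictMono_tendsto_of_wellFounded (hwf : WellFounded fun α β => μ α < μ β) {l : ℝ}
    (hl : ∀ ε > 0, ∃ α, μ α ≠ l ∧ |μ α - l| < ε) :
    ∃ s : ℕ → ℝ, StrictMono s ∧ (∀ n, s n ∈ Set.range μ) ∧ Tendsto s atTop (𝓝 l) := by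
  obtain ⟨ε, hε, hgap⟩ := exists_gap_above hwf l
  have hbelow (b : ℝ) (hb : b < l) : ∃ α, b < μ α ∧ μ α < l := by
    obtain ⟨α, hne, hα⟩ := hl (min ε (l - b)) (lt_min hε (sub_pos.2 hb))
    have h1 := abs_lt.1 (hα.trans_le (min_le_left _ _))
    have h2 := abs_lt.1 (hα.trans_le (min_le_right _ _))
    refine ⟨α, by linarith, ?_⟩
    rcases hgap α with h | h
    · exact h.lt_of_ne hne
    · linarith
  -- The gap above `l` forces nearby values below it, so `l` is an unattained supremum.
  have hlub : IsLUB (Set.range μ ∩ Set.Iio l) l := by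
    refine ⟨fun x hx => hx.2.le, fun b hb => not_lt.1 fun hlt => ?_⟩
    obtain ⟨α, h1, h2⟩ := hbelow b hlt
    exact absurd (hb ⟨⟨α, rfl⟩, h2⟩) (not_le.2 h1)
  obtain ⟨α, -, hα⟩ := hbelow (l - 1) (sub_one_lt l)
  obtain ⟨s, hs, -, hlim, hmem⟩ := hlub.exists_seq_strictMono_tendsto_of_notMem
    (fun h => lt_irrefl l h.2) ⟨μ α, ⟨α, rfl⟩, hα⟩
  exact ⟨s, hs, fun n => (hmem n).1, hlim⟩

theorem eventually_lt_of_tendsto_of_wellFounded (hwf : WellFounded fun α β => μ α < μ β) {l : ℝ}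
    {s : ℕ → ℝ} (hs : ∀ n, (s n : ℂ) ∈ closure (Set.range fun α => (μ α : ℂ)) ∧ s n ≠ l)
    (hlim : Tendsto s atTop (𝓝 l)) : ∀ᶠ n in atTop, s n < l := by
  obtain ⟨ε, hε, hgap⟩ := exists_gap_above hwf l
  -- Stated as a closed condition, the gap above `l` passes to the closure.
  have hclosed : IsClosed {z : ℂ | z.re ≤ l ∨ l + ε ≤ z.re} :=
    (isClosed_le Complex.continuous_re continuous_const).union
      (isClosed_le continuous_const Complex.continuous_re)
  have hsub : closure (Set.range fun α => (μ α : ℂ)) ⊆ {z : ℂ | z.re ≤ l ∨ l + ε ≤ z.re} :=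
    closure_minimal (by rintro _ ⟨α, rfl⟩; exact hgap α) hclosed
  filter_upwards [hlim.eventually_lt_const (lt_add_of_pos_right l hε)] with n hn
  have h : s n ≤ l ∨ l + ε ≤ s n := hsub (hs n).1
  exact (h.resolve_right (not_le.2 hn)).lt_of_ne (hs n).2

end RealFamily

/-! ### Assembly -/

theorem theorem5p2 {H : Type*} [NormedAddCommGroup H] [InnerProductSpace ℂ H] [CompleteSpace H]
    (T : H →L[ℂ] H) (hAM : IsAbsMinAttaining T) (hpos : T.IsPositive)
    (hinj : Function.Injective T) :
    ∃ (Λ : Set H) (v : HilbertBasis Λ ℂ H) (μ : Λ → ℝ),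
      -- `T = ∑ μ α • (v α ⊗ v α)`, with a basis of eigenvectors
      (∀ α, 0 ≤ μ α) ∧
      (∀ α, T (v α) = (μ α : ℂ) • v α) ∧
      (∀ x : H, HasSum (fun α => (μ α : ℂ) • InnerProductSpace.rankOne ℂ (v α) (v α) x) (T x)) ∧
      -- infima of eigenvalues are minima
      (∀ Γ : Set Λ, Γ.Nonempty → IsLeast (μ '' Γ) (sInf (μ '' Γ))) ∧
      -- the spectrum and its limit point
      spectrum ℂ T = closure (Set.range fun α => (μ α : ℂ)) ∧
      {z : ℂ | AccPt z (𝓟 (spectrum ℂ T))}.Subsingleton ∧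
      (∀ z : ℂ, AccPt z (𝓟 (spectrum ℂ T)) → ∃ l : ℝ, z = (l : ℂ) ∧
        (∃ s : ℕ → ℝ, StrictMono s ∧ (∀ n, (s n : ℂ) ∈ spectrum ℂ T) ∧
          Tendsto s atTop (𝓝 l)) ∧
        (∀ s : ℕ → ℝ, (∀ n, (s n : ℂ) ∈ spectrum ℂ T ∧ s n ≠ l) →
          Tendsto s atTop (𝓝 l) → ∀ᶠ n in atTop, s n < l)) ∧
      -- the set of eigenvalues
      {z : ℂ | Module.End.HasEigenvalue (T : H →ₗ[ℂ] H) z} = Set.range (fun α => (μ α : ℂ)) ∧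
      (Set.range μ).Countable ∧
      {z : ℂ | Module.End.HasEigenvalue (T : H →ₗ[ℂ] H) z ∧
        ¬ FiniteDimensional ℂ (Module.End.eigenspace (T : H →ₗ[ℂ] H) z)}.Subsingleton ∧
      -- a limit point and an eigenvalue of infinite multiplicity coincide
      (∀ z w : ℂ, AccPt z (𝓟 (spectrum ℂ T)) →
        Module.End.HasEigenvalue (T : H →ₗ[ℂ] H) w →
        ¬ FiniteDimensional ℂ (Module.End.eigenspace (T : H →ₗ[ℂ] H) w) → z = w) := by
  obtain ⟨Λ, v, μ, hμ, hTv⟩ := hAM.exists_hilbertBasis_eigenvectors hpos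
  have hsym : (T : H →ₗ[ℂ] H).IsSymmetric := hpos.isSelfAdjoint.isSymmetric
  have hwf := hAM.wellFounded_eigenvalues v.orthonormal hμ hTv
  have hgap (A B : ℝ) (hAB : A < B) : {α | μ α ≤ A}.Finite ∨ {α | B ≤ μ α}.Finite :=
    hAM.finite_or_finite v.orthonormal hμ hTv hAB
  have hspec := HilbertBasis.spectrum_diagonal hTv
  have hacc {z : ℂ} (hz : AccPt z (𝓟 (spectrum ℂ T))) :
      ∃ l : ℝ, z = l ∧ ∀ ε > 0, {α | |μ α - l| < ε}.Infinite := by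
    obtain ⟨l, hl, h⟩ := exists_ofReal_eq_of_accPt_closure_range (hspec ▸ hz)
    exact ⟨l, hl, fun ε hε => infinite_setOf_abs_sub_lt h hε⟩
  -- Infinite multiplicity yields the same clustering of indices as a limit point, so `huniq`
  -- settles all three uniqueness claims.
  have hmult {z : ℂ}
      (hz : ¬ FiniteDimensional ℂ (Module.End.eigenspace (T : H →ₗ[ℂ] H) z)) :
      ∃ l : ℝ, z = l ∧ ∀ ε > 0, {α | |μ α - l| < ε}.Infinite := by
    have hinf := HilbertBasis.infinite_of_not_finiteDimensional_eigenspace hTv hsym hz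
    obtain ⟨α, hα⟩ := hinf.nonempty
    refine ⟨μ α, hα.symm, fun ε hε => hinf.mono fun β hβ => ?_⟩
    have h : μ β = μ α := Complex.ofReal_injective (Eq.trans hβ hα.symm)
    change |μ β - μ α| < ε
    rwa [h, sub_self, abs_zero]
  have huniq {z w : ℂ} (hz : ∃ l : ℝ, z = l ∧ ∀ ε > 0, {α | |μ α - l| < ε}.Infinite)
      (hw : ∃ l : ℝ, w = l ∧ ∀ ε > 0, {α | |μ α - l| < ε}.Infinite) : z = w := by
    obtain ⟨l, rfl, hl⟩ := hz
    obtain ⟨l', rfl, hl'⟩ := hw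
    rw [eq_of_infinite_setOf_abs_sub_lt hgap hl hl']
  refine ⟨Λ, v, μ, hμ, hTv, HilbertBasis.hasSum_diagonal hTv,
    fun Γ hΓ => isLeast_sInf_image_of_wellFounded hwf hΓ, hspec,
    fun z hz w hw => huniq (hacc hz) (hacc hw), fun z hz => ?_,
    HilbertBasis.setOf_hasEigenvalue_diagonal hTv hsym, countable_range_of_wellFounded hwf,
    fun z hz w hw => huniq (hmult hz.2) (hmult hw.2),
    fun z w hz _ hw => huniq (hacc hz) (hmult hw)⟩
  rw [hspec] at hz ⊢
  obtain ⟨l, rfl, hl⟩ := exists_ofReal_eq_of_accPt_closure_range hz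
  refine ⟨l, rfl, ?_, fun s hs hlim => eventually_lt_of_tendsto_of_wellFounded hwf hs hlim⟩
  obtain ⟨s, hs, hmem, hlim⟩ := exists_strictMono_tendsto_of_wellFounded hwf hl
  refine ⟨s, hs, fun n => subset_closure ?_, hlim⟩
  obtain ⟨α, hα⟩ := hmem n
  exact ⟨α, congrArg _ hα⟩
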